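/- Let $N\ge 1$, let $\beta\ge\sqrt8$, and let $\Omega\subset\mathbb R^N$ be either a hyperrectangle (a product of $N$ bounded nonempty open intervals) or a bounded domain (connected open set) with $C^\infty$ boundary. Assume in both cases that $\Omega$ is convex and symmetric in the $e_1$-direction, that is, for every $x=(x_1,\dots,x_N)\in\Omega$ one has $\{(tx_1,x_2,\dots,x_N): t\in[-1,1]\}\subset\Omega$. Let $u$ be a positive classical solution of $$\Delta^2u-\beta\Delta u=u-u^3\ \text{ in }\Omega,\qquad u=\Delta u=0\ \text{ on }\partial\Omega,$$ that is, $u\in C^4(\Omega)$ satisfies the equation pointwise, $u$ and $\Delta u$ extend continuously to $\overline\Omega$ with value $0$ on $\partial\Omega$, and $u>0$ in $\Omega$. Then $$u(x_1,x_2,\dots,x_N)=u(-x_1,x_2,\dots,x_N)\quad\text{for all }x\in\Omega,$$ $$\partial_{x_1}u(x)<0\quad\text{for all }x\in\Omega\text{ with }x_1>0.$$ -/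

import Mathlib

open Set Filter Topology
open scoped ContDiff

/-- The point `(s, x₂, …, x_N)` obtained from `x = (x₁, x₂, …, x_N)` by replacing the first
coordinate (which has index `0 : Fin N`). -/
noncomputable def withFirst {N : ℕ} [NeZero N] (x : EuclideanSpace ℝ (Fin N)) (s : ℝ) :
    EuclideanSpace ℝ (Fin N) :=
  WithLp.toLp 2 (Function.update x.ofLp 0 s)

/-- The partial derivative `∂u/∂x₁` at `x`. -/
noncomputable def partialFirst {N : ℕ} [NeZero N] (u : EuclideanSpace ℝ (Fin N) → ℝ)
    (x : EuclideanSpace ℝ (Fin N)) : ℝ :=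
  fderiv ℝ u x (EuclideanSpace.single 0 1)

/-- A hyperrectangle: a product of `N` bounded nonempty open intervals. -/
def IsHyperrectangle {N : ℕ} (Ω : Set (EuclideanSpace ℝ (Fin N))) : Prop :=
  ∃ a b : Fin N → ℝ, (∀ i, a i < b i) ∧ Ω = {x | ∀ i, x i ∈ Ioo (a i) (b i)}

/-- A smooth bounded domain: a bounded, connected, open set which near each of its boundary points
is the strict sublevel set `{ρ < 0}` of a `C^∞` function `ρ` with nonvanishing differential. -/
structure IsSmoothBoundedDomain {N : ℕ} (Ω : Set (EuclideanSpace ℝ (Fin N))) : Prop where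
  isOpen : IsOpen Ω
  isConnected : IsConnected Ω
  isBounded : Bornology.IsBounded Ω
  smooth_boundary : ∀ p ∈ frontier Ω, ∃ U : Set (EuclideanSpace ℝ (Fin N)),
    ∃ ρ : EuclideanSpace ℝ (Fin N) → ℝ, IsOpen U ∧ p ∈ U ∧ ContDiffOn ℝ ∞ ρ U ∧
      (∀ x ∈ U, fderiv ℝ ρ x ≠ 0) ∧ Ω ∩ U = {x ∈ U | ρ x < 0}

/-- `Ω` is convex and symmetric in the `e₁`-direction: with `x` it contains all points
`(t x₁, x₂, …, x_N)` with `t ∈ [-1, 1]`. -/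
def IsConvexSymmFirst {N : ℕ} [NeZero N] (Ω : Set (EuclideanSpace ℝ (Fin N))) : Prop :=
  ∀ x ∈ Ω, ∀ t ∈ Icc (-1 : ℝ) 1, withFirst x (t * x 0) ∈ Ω

/-- `u` is a classical solution of `Δ² u - β Δ u = u - u³` in the open set `Ω` with Navier boundary
conditions `u = Δ u = 0` on `∂Ω`: `u ∈ C⁴(Ω)`, the equation holds pointwise in `Ω`, and `u` and
`Δ u` extend continuously by `0` to `∂Ω`. Only the values of `u` in `Ω` matter. -/
structure IsClassicalSolution {N : ℕ} (β : ℝ) (Ω : Set (EuclideanSpace ℝ (Fin N)))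
    (u : EuclideanSpace ℝ (Fin N) → ℝ) : Prop where
  contDiffOn : ContDiffOn ℝ 4 u Ω
  equation : ∀ x ∈ Ω, Laplacian.laplacian (Laplacian.laplacian u) x
    - β * Laplacian.laplacian u x = u x - u x ^ 3
  boundary_value : ∀ y ∈ frontier Ω, Tendsto u (𝓝[Ω] y) (𝓝 0)
  boundary_laplacian : ∀ y ∈ frontier Ω,
    Tendsto (Laplacian.laplacian u) (𝓝[Ω] y) (𝓝 0)

/-! ### Second-order calculus for the Laplacian. -/

section Laplacian

open Laplacian InnerProductSpace

variable {E : Type*} [NormedAddCommGroup E] [InnerProductSpace ℝ E] [FiniteDimensional ℝ E]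

/-! With `κ = β / 2` and `v = κ u - Δu`, the equation becomes the second-order system `-Δu + κu =
v`, `-Δv + κv = (1 + κ²)u - u³` with zero boundary values, and `β ≥ √8` becomes `κ² ≥ 2`. The
maximum principle gives `u ≤ 1` and `v ≥ 0`.

For a reflection `R`, put `U = u ∘ R - u` and `V = v ∘ R - v`. Then `-ΔU + κU = V` and `-ΔV + κV =
kU`, where `k = 1 + κ² - (q² + qp + p²)`, `p = u` and `q = u ∘ R`. Since `0 ≤ p, q ≤ 1` and `κ² ≥
2`, `k ≥ 0`: the linear system is cooperative, so a positive strict supersolution yields `U, V ≥ 0`.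

The pair `(u, v)` is itself a supersolution, because `(1 + κ²)p - p³ = kp + (q² + qp)p`. The gain
`(q² + qp)p` is positive inside `Ω` but degenerates at `∂Ω`. A small barrier built from uniform
exterior balls repairs this, which is the only use of the boundary regularity. The comparison
`IsNavierPair.le_comp_isometry` therefore holds on every cap at once, and no plane has to be moved
continuously.

Applied to all of `Ω` and the reflection in `{x₁ = 0}`, it gives symmetry. On the caps `{x₁ > l}`,
the strong maximum principle makes `U ≥ 0` strict, and Hopf's lemma at a point of the mirror turns
this into `∂u/∂x₁ < 0`. -/

omit [FiniteDimensional ℝ E] in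
theorem fderiv_fderiv_apply_eq_deriv_deriv {f : E → ℝ} {x : E} (hf : ContDiffAt ℝ 2 f x) (e : E) :
    fderiv ℝ (fderiv ℝ f) x e e = deriv (deriv fun t : ℝ => f (x + t • e)) 0 := by
  have hline : ∀ t : ℝ, HasDerivAt (fun t : ℝ => x + t • e) e t := fun t => by
    simpa using ((hasDerivAt_id t).smul_const e).const_add x
  have hcont : Tendsto (fun t : ℝ => x + t • e) (𝓝 0) (𝓝 x) := by
    simpa [ContinuousAt] using (hline 0).continuousAt
  have h1 : (deriv fun t : ℝ => f (x + t • e)) =ᶠ[𝓝 0] fun t => fderiv ℝ f (x + t • e) e := by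
    have : ∀ᶠ y in 𝓝 x, DifferentiableAt ℝ f y :=
      (hf.eventually (by simp)).mono fun y hy => hy.differentiableAt (by simp)
    filter_upwards [hcont.eventually this] with t ht
    exact (ht.hasFDerivAt.comp_hasDerivAt t (hline t)).deriv
  rw [h1.deriv_eq]
  have h2 : HasFDerivAt (fderiv ℝ f) (fderiv ℝ (fderiv ℝ f) x) (x + (0 : ℝ) • e) := by
    simpa using ((hf.fderiv_right (m := 1) (by norm_num)).differentiableAt (by simp)).hasFDerivAt
  have h3 : HasDerivAt (fun t : ℝ => fderiv ℝ f (x + t • e)) (fderiv ℝ (fderiv ℝ f) x e) 0 :=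
    h2.comp_hasDerivAt (0 : ℝ) (hline 0)
  have h4 : HasDerivAt (fun t : ℝ => fderiv ℝ f (x + t • e) e) (fderiv ℝ (fderiv ℝ f) x e e) 0 :=
    (ContinuousLinearMap.apply ℝ ℝ e).hasFDerivAt.comp_hasDerivAt (0 : ℝ) h3
  exact h4.deriv.symm

theorem laplacian_eq_sum_deriv_deriv {ι : Type*} [Fintype ι] (b : OrthonormalBasis ι ℝ E)
    {f : E → ℝ} {x : E} (hf : ContDiffAt ℝ 2 f x) :
    Δ f x = ∑ i, deriv (deriv fun t : ℝ => f (x + t • b i)) 0 := by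
  rw [laplacian_eq_iteratedFDeriv_orthonormalBasis f b]
  refine Finset.sum_congr rfl fun i _ => ?_
  rw [iteratedFDeriv_two_apply, ← fderiv_fderiv_apply_eq_deriv_deriv hf]
  simp

/-- A negative second derivative would make the critical point also a local maximum, so the function
would be locally constant and its second derivative zero. -/
theorem IsLocalMin.deriv_deriv_nonneg {f : ℝ → ℝ} {x : ℝ} (h : IsLocalMin f x)
    (hc : ContinuousAt f x) : 0 ≤ deriv (deriv f) x := by
  by_contra! hneg
  have hmax := isLocalMax_of_deriv_deriv_neg hneg h.deriv_eq_zero hc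
  have hconst : f =ᶠ[𝓝 x] fun _ => f x := by
    filter_upwards [h, hmax] with y h1 h2 using le_antisymm h2 h1
  have h2 : deriv f =ᶠ[𝓝 x] deriv fun _ => f x := hconst.deriv
  rw [h2.deriv_eq] at hneg
  simp at hneg

theorem IsLocalMin.laplacian_nonneg {f : E → ℝ} {x : E} (h : IsLocalMin f x)
    (hf : ContDiffAt ℝ 2 f x) : 0 ≤ Δ f x := by
  rw [laplacian_eq_sum_deriv_deriv (stdOrthonormalBasis ℝ E) hf]
  refine Finset.sum_nonneg fun i _ => ?_
  have hc : ContinuousAt (fun t : ℝ => x + t • stdOrthonormalBasis ℝ E i) 0 := by fun_prop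
  have hx : x + (0 : ℝ) • stdOrthonormalBasis ℝ E i = x := by simp
  refine IsLocalMin.deriv_deriv_nonneg ?_ ?_
  · have := hc.tendsto.eventually (by rw [hx]; exact h)
    filter_upwards [this] with t ht
    simpa using ht
  · exact ContinuousAt.comp (f := fun t : ℝ => x + t • stdOrthonormalBasis ℝ E i) (x := (0 : ℝ))
      (by rw [hx]; exact hf.continuousAt) hc

theorem IsLocalMax.laplacian_nonpos {f : E → ℝ} {x : E} (h : IsLocalMax f x)
    (hf : ContDiffAt ℝ 2 f x) : Δ f x ≤ 0 := by
  have := IsLocalMin.laplacian_nonneg (f := -f) h.neg hf.neg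
  rw [InnerProductSpace.laplacian_neg] at this
  simpa using this

/-- The Laplacian may be computed in any orthonormal basis; the image of the basis under `A` matches
the two sums term by term. -/
theorem laplacian_comp_isometry (A : E ≃ₗᵢ[ℝ] E) (c : E) {f : E → ℝ} {x : E}
    (hf : ContDiffAt ℝ 2 f (A x + c)) :
    Δ (fun y => f (A y + c)) x = Δ f (A x + c) := by
  let b := stdOrthonormalBasis ℝ E
  have h : ContDiffAt ℝ 2 (fun y => f (A y + c)) x :=
    hf.comp x (f := fun y => A y + c) (A.contDiff.add contDiff_const).contDiffAt
  rw [laplacian_eq_sum_deriv_deriv b h, laplacian_eq_sum_deriv_deriv (b.map A) hf]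
  refine Finset.sum_congr rfl fun i _ => ?_
  congr 2
  ext t
  congr 1
  simp only [map_add, map_smul, OrthonormalBasis.map_apply]
  abel

omit [FiniteDimensional ℝ E] in
theorem contDiff_exp_sub_norm_sq (a c : ℝ) (y : E) {n : ℕ∞} :
    ContDiff ℝ n fun x : E => Real.exp (a * (c - ‖x - y‖ ^ 2)) :=
  (contDiff_const.mul (contDiff_const.sub ((contDiff_id.sub contDiff_const).norm_sq ℝ))).exp

theorem laplacian_exp_sub_norm_sq (a c : ℝ) (y x : E) :
    Δ (fun x : E => Real.exp (a * (c - ‖x - y‖ ^ 2))) x =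
      (4 * a ^ 2 * ‖x - y‖ ^ 2 - 2 * a * Module.finrank ℝ E) *
        Real.exp (a * (c - ‖x - y‖ ^ 2)) := by
  let b := stdOrthonormalBasis ℝ E
  rw [laplacian_eq_sum_deriv_deriv b (contDiff_exp_sub_norm_sq a c y).contDiffAt]
  have key : ∀ i, deriv (deriv fun t : ℝ => Real.exp (a * (c - ‖x + t • b i - y‖ ^ 2))) 0 =
      (4 * a ^ 2 * inner ℝ (b i) (x - y) ^ 2 - 2 * a) * Real.exp (a * (c - ‖x - y‖ ^ 2)) := by
    intro i
    set s := inner ℝ (b i) (x - y) with hs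
    have h0 : (fun t : ℝ => Real.exp (a * (c - ‖x + t • b i - y‖ ^ 2))) =
        fun t : ℝ => Real.exp (a * (c - (‖x - y‖ ^ 2 + 2 * t * s + t ^ 2))) := by
      ext t
      have : x + t • b i - y = (x - y) + t • b i := by abel
      rw [this, norm_add_sq_real, norm_smul, inner_smul_right, real_inner_comm, ← hs]
      simp only [b.norm_eq_one i, mul_one, Real.norm_eq_abs, sq_abs]
      ring_nf
    have h1 : ∀ t : ℝ, HasDerivAt
        (fun t : ℝ => Real.exp (a * (c - (‖x - y‖ ^ 2 + 2 * t * s + t ^ 2))))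
        (Real.exp (a * (c - (‖x - y‖ ^ 2 + 2 * t * s + t ^ 2))) * (a * -(2 * s + 2 * t))) t := by
      intro t
      have : HasDerivAt (fun t : ℝ => a * (c - (‖x - y‖ ^ 2 + 2 * t * s + t ^ 2)))
          (a * -(2 * s + 2 * t)) t := by
        have h := ((((hasDerivAt_id t).const_mul 2).mul_const s).const_add (‖x - y‖ ^ 2)).add
          (hasDerivAt_pow 2 t)
        have := (h.const_sub c).const_mul a
        exact this.congr_deriv (by norm_num)
      exact this.exp
    rw [h0, funext fun t => (h1 t).deriv]
    have h2 : HasDerivAt (fun t : ℝ => a * -(2 * s + 2 * t)) (a * -2) 0 := by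
      have := (((((hasDerivAt_id (0 : ℝ)).const_mul 2).const_add (2 * s))).neg).const_mul a
      exact this.congr_deriv (by norm_num)
    refine ((h1 0).mul h2).deriv.trans ?_
    simp
    ring
  rw [Finset.sum_congr rfl fun i _ => key i, ← Finset.sum_mul, Finset.sum_sub_distrib,
    ← Finset.mul_sum, b.sum_sq_inner_right]
  simp
  ring

end Laplacian

/-! ### Hopf's lemma and the strong maximum principle. -/

section StrongMaximumPrinciple

open Laplacian InnerProductSpace Metric

variable {E : Type*} [NormedAddCommGroup E] [InnerProductSpace ℝ E] [FiniteDimensional ℝ E]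

omit [FiniteDimensional ℝ E] in
theorem fderiv_exp_sub_norm_sq_apply (a c : ℝ) (y x e : E) :
    fderiv ℝ (fun x : E => Real.exp (a * (c - ‖x - y‖ ^ 2))) x e =
      Real.exp (a * (c - ‖x - y‖ ^ 2)) * (a * -(2 * inner ℝ (x - y) e)) := by
  have h : HasFDerivAt (fun x : E => x - y) (ContinuousLinearMap.id ℝ E) x :=
    (hasFDerivAt_id x).sub_const y
  have h2 := ((h.norm_sq.const_sub c).const_mul a).exp
  rw [h2.fderiv]
  simp [inner_sub_left]

theorem exists_coeff_laplacian_exp (κ ρ : ℝ) (hκ : 0 ≤ κ) (hρ : 0 < ρ) :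
    ∃ a : ℝ, 0 < a ∧ ∀ w x : E, ρ / 2 ≤ ‖x - w‖ →
      κ * Real.exp (a * (ρ ^ 2 - ‖x - w‖ ^ 2)) <
        Δ (fun x : E => Real.exp (a * (ρ ^ 2 - ‖x - w‖ ^ 2))) x := by
  set n : ℝ := (Module.finrank ℝ E : ℝ) with hn
  have hn0 : 0 ≤ n := Nat.cast_nonneg _
  -- For `‖x - w‖ ≥ ρ / 2` the factor in the Laplacian is at least `a (a ρ² - 2n) ≥ a (κ + 1) > κ`.
  set a := max 1 ((2 * n + κ + 1) / ρ ^ 2) with ha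
  have ha1 : 1 ≤ a := le_max_left _ _
  have ha2 : 2 * n + κ + 1 ≤ a * ρ ^ 2 := by
    rw [← div_le_iff₀ (by positivity)]
    exact le_max_right _ _
  refine ⟨a, by linarith, fun w x hx => ?_⟩
  rw [laplacian_exp_sub_norm_sq]
  refine mul_lt_mul_of_pos_right ?_ (Real.exp_pos _)
  have h1 : (ρ / 2) ^ 2 ≤ ‖x - w‖ ^ 2 := by gcongr
  have h2 : a * (2 * n + κ + 1) ≤ a * (a * ρ ^ 2) := by gcongr
  nlinarith [mul_le_mul_of_nonneg_left h1 (by positivity : 0 ≤ 4 * a ^ 2),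
    mul_le_mul_of_nonneg_right ha1 hκ]

/-- The Hopf boundary point lemma on a ball. -/
theorem hopf_boundary_point {O : Set E} (hO : IsOpen O) {U : E → ℝ} (hU : ContDiffOn ℝ 2 U O)
    {κ : ℝ} (hκ : 0 ≤ κ) {w q : E} (hB : closedBall w (dist q w) ⊆ O) (hqw : q ≠ w)
    (hL : ∀ x ∈ ball w (dist q w), Δ U x ≤ κ * U x) (hpos : ∀ x ∈ ball w (dist q w), 0 < U x)
    (hq : U q = 0) : 0 < fderiv ℝ U q (w - q) := by
  set ρ := dist q w with hρd
  have hρ : 0 < ρ := dist_pos.2 hqw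
  obtain ⟨a, ha, hlap⟩ := exists_coeff_laplacian_exp (E := E) κ ρ hκ hρ
  set b : E → ℝ := fun x => Real.exp (a * (ρ ^ 2 - ‖x - w‖ ^ 2)) with hb
  have hbC : ContDiff ℝ 2 b := contDiff_exp_sub_norm_sq a (ρ ^ 2) w (n := 2)
  have hUc : ContinuousOn U (closedBall w ρ) := hU.continuousOn.mono hB
  have hUat : ∀ x ∈ closedBall w ρ, ContDiffAt ℝ 2 U x := fun x hx =>
    hU.contDiffAt (hO.mem_nhds (hB hx))
  have hU0 : ∀ x ∈ closedBall w ρ, 0 ≤ U x := by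
    intro x hx
    rw [← closure_ball w hρ.ne'] at hx hUc
    exact le_on_closure (f := fun _ => 0) (fun y hy => (hpos y hy).le) continuousOn_const hUc hx
  obtain ⟨x₁, hx₁, hmin₁⟩ := (isCompact_closedBall w (ρ / 2)).exists_isMinOn
    ⟨w, mem_closedBall_self (by positivity)⟩
    (hUc.mono (closedBall_subset_closedBall (by linarith)))
  set m := U x₁ with hm
  have hm0 : 0 < m := hpos _ (closedBall_subset_ball (by linarith) hx₁)
  -- This makes `ε b ≤ m ≤ U` on the inner ball of radius `ρ / 2`.
  set ε := m / Real.exp (a * ρ ^ 2) with hε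
  have hε0 : 0 < ε := by positivity
  have hεm : ε * Real.exp (a * ρ ^ 2) = m := by rw [hε]; field_simp
  set W : E → ℝ := U - ε • b with hW
  have hWx : ∀ x, W x = U x - ε * b x := fun x => rfl
  have hWc : ContinuousOn W (closedBall w ρ) :=
    hUc.sub (hbC.continuous.const_smul ε).continuousOn
  obtain ⟨x₀, hx₀, hmin⟩ := (isCompact_closedBall w ρ).exists_isMinOn
    ⟨w, mem_closedBall_self hρ.le⟩ hWc
  -- A minimum below `-ε` is excluded on the inner ball by the choice of `ε`, and on the sphere by
  -- `b = 1` and `U ≥ 0`. In the open annulus it would give `κU ≥ ΔU ≥ εΔb > κεb ≥ κU`.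
  have hkey : -ε ≤ W x₀ := by
    by_contra! hlt
    have hnorm : ρ / 2 < ‖x₀ - w‖ := by
      by_contra! hle
      have h1 : m ≤ U x₀ := hmin₁ (by rwa [mem_closedBall, dist_eq_norm])
      have h2 : b x₀ ≤ Real.exp (a * ρ ^ 2) := by
        refine Real.exp_le_exp.2 ?_
        gcongr
        nlinarith [sq_nonneg ‖x₀ - w‖]
      have h3 := mul_le_mul_of_nonneg_left h2 hε0.le
      rw [hWx] at hlt
      linarith
    have hnorm2 : ‖x₀ - w‖ < ρ := by
      rw [mem_closedBall, dist_eq_norm] at hx₀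
      refine lt_of_le_of_ne hx₀ fun he => ?_
      have h1 := hU0 x₀ (by rw [mem_closedBall, dist_eq_norm]; exact hx₀)
      have h2 : b x₀ = 1 := by simp [hb, he]
      rw [hWx, h2] at hlt
      linarith
    have hball : x₀ ∈ ball w ρ := by rwa [mem_ball, dist_eq_norm]
    have hloc : IsLocalMin W x₀ := hmin.isLocalMin (closedBall_mem_nhds_of_mem hball)
    have hC : ContDiffAt ℝ 2 (ε • b) x₀ := (hbC.const_smul ε).contDiffAt
    have h1 := hloc.laplacian_nonneg ((hUat x₀ hx₀).sub hC)
    rw [hW, (hUat x₀ hx₀).laplacian_sub hC, laplacian_smul ε hbC.contDiffAt, smul_eq_mul] at h1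
    have h2 := hL x₀ hball
    have h3 := mul_lt_mul_of_pos_left (hlap w x₀ hnorm.le) hε0
    rw [hWx] at hlt
    have h4 : κ * U x₀ ≤ κ * (ε * b x₀) := by
      refine mul_le_mul_of_nonneg_left ?_ hκ
      linarith
    have h5 : b x₀ = Real.exp (a * (ρ ^ 2 - ‖x₀ - w‖ ^ 2)) := rfl
    rw [← h5] at h3
    linarith
  have hbq : b q = 1 := by
    simp [hb, ← dist_eq_norm, ← hρd]
  have hWq : W q = -ε := by rw [hWx, hq, hbq]; ring
  have hminq : IsMinOn W (closedBall w ρ) q := fun x hx => by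
    have := hmin hx
    simp only [mem_ofPred_eq] at this ⊢
    linarith
  have hqB : q ∈ closedBall w ρ := by simp [hρd]
  have hbd : DifferentiableAt ℝ b q := hbC.contDiffAt.differentiableAt (by simp)
  have hUd : DifferentiableAt ℝ U q := (hUat q hqB).differentiableAt (by simp)
  have hWd : HasFDerivAt W (fderiv ℝ U q - ε • fderiv ℝ b q) q :=
    hUd.hasFDerivAt.sub (hbd.hasFDerivAt.const_smul ε)
  -- Since `W` is minimal at `q` over the ball, the inward derivative of `U` is at least that of `ε
  -- b`, which is positive.
  have hnn := hminq.localize.hasFDerivWithinAt_nonneg hWd.hasFDerivWithinAt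
    (sub_mem_posTangentConeAt_of_segment_subset
      ((convex_closedBall w ρ).segment_subset hqB (mem_closedBall_self hρ.le)))
  have hbf : fderiv ℝ b q (w - q) = 2 * a * ρ ^ 2 := by
    have h1 : inner ℝ (q - w) (w - q) = -ρ ^ 2 := by
      rw [← neg_sub q w, inner_neg_right, real_inner_self_eq_norm_sq, ← dist_eq_norm]
    have h2 : fderiv ℝ b q (w - q) = b q * (a * -(2 * inner ℝ (q - w) (w - q))) :=
      fderiv_exp_sub_norm_sq_apply a (ρ ^ 2) w q (w - q)
    rw [h2, h1, hbq]
    ring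
  simp only [sub_apply, smul_apply, hbf, smul_eq_mul] at hnn
  have : 0 < ε * (2 * a * ρ ^ 2) := by positivity
  linarith

/-- The strong maximum principle in its local form. -/
theorem eventually_eq_zero_of_laplacian_le {O : Set E} (hO : IsOpen O) {U : E → ℝ}
    (hU : ContDiffOn ℝ 2 U O) {κ : ℝ} (hκ : 0 ≤ κ) (hL : ∀ x ∈ O, Δ U x ≤ κ * U x)
    (hnn : ∀ x ∈ O, 0 ≤ U x) {z : E} (hz : z ∈ O) (hUz : U z = 0) : ∀ᶠ x in 𝓝 z, U x = 0 := by
  obtain ⟨R, hR, hRO⟩ := nhds_basis_closedBall.mem_iff.1 (hO.mem_nhds hz)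
  filter_upwards [ball_mem_nhds z (half_pos hR)] with w hw
  by_contra hne
  have hZ : IsCompact (closedBall z R ∩ U ⁻¹' {0}) :=
    (isCompact_closedBall z R).of_isClosed_subset
      ((hU.continuousOn.mono hRO).preimage_isClosed_of_isClosed isClosed_closedBall
        isClosed_singleton) inter_subset_left
  have hzZ : z ∈ closedBall z R ∩ U ⁻¹' {0} := ⟨mem_closedBall_self hR.le, hUz⟩
  -- The ball about `w` reaching to the nearest zero `q` is free of zeros, so Hopf's lemma applies
  -- at `q`; but `q` is a minimum of `U`, with zero gradient. As `w` is within `R / 2` of `z`, this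
  -- ball stays in `closedBall z R`.
  obtain ⟨q, ⟨hqB, hq⟩, hqd⟩ := hZ.exists_infDist_eq_dist ⟨z, hzZ⟩ w
  have hqw : dist q w < R / 2 := by
    rw [dist_comm, ← hqd]
    exact (infDist_le_dist_of_mem hzZ).trans_lt hw
  have hsub : closedBall w (dist q w) ⊆ closedBall z R :=
    closedBall_subset_closedBall' (by rw [mem_ball] at hw; linarith)
  have hpos := hopf_boundary_point hO hU hκ (hsub.trans hRO) (fun h => hne (h ▸ hq))
    (fun x hx => hL x (hRO (hsub (ball_subset_closedBall hx))))
    (fun x hx => (hnn x (hRO (hsub (ball_subset_closedBall hx)))).lt_of_ne' fun h0 => by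
      have := infDist_le_dist_of_mem (x := w)
        (show x ∈ closedBall z R ∩ U ⁻¹' {0} from ⟨hsub (ball_subset_closedBall hx), h0⟩)
      rw [hqd, dist_comm w q, dist_comm w x] at this
      exact absurd (mem_ball.1 hx) (not_lt.2 this)) hq
  have hmin : IsLocalMin U q := by
    filter_upwards [hO.mem_nhds (hRO hqB)] with x hx
    rw [show U q = 0 from hq]
    exact hnn x hx
  rw [hmin.fderiv_eq_zero] at hpos
  simp at hpos

end StrongMaximumPrinciple

/-! ### Uniform exterior balls. -/

section ExteriorBall

open Metric

variable {N : ℕ} {Ω : Set (EuclideanSpace ℝ (Fin N))}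

theorem IsHyperrectangle.isOpen (h : IsHyperrectangle Ω) : IsOpen Ω := by
  obtain ⟨a, b, -, rfl⟩ := h
  have : {x : EuclideanSpace ℝ (Fin N) | ∀ i, x i ∈ Ioo (a i) (b i)} =
      ⋂ i, (fun x : EuclideanSpace ℝ (Fin N) => x i) ⁻¹' Ioo (a i) (b i) := by
    ext; simp
  rw [this]
  exact isOpen_iInter_of_finite fun i => isOpen_Ioo.preimage (by fun_prop)

theorem IsHyperrectangle.isBounded (h : IsHyperrectangle Ω) : Bornology.IsBounded Ω := by
  obtain ⟨a, b, -, rfl⟩ := h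
  have h1 : Bornology.IsBounded (Set.pi univ fun i => Icc (a i) (b i)) :=
    (isCompact_univ_pi fun i => isCompact_Icc).isBounded
  have h2 := (PiLp.antilipschitzWith_ofLp 2 fun _ : Fin N => ℝ).isBounded_preimage h1
  refine h2.subset fun x hx => ?_
  simp only [mem_preimage, mem_univ_pi]
  exact fun i => ⟨(hx i).1.le, (hx i).2.le⟩

/-- A boundary point violates one of the coordinate constraints, and a ball of any radius fits
beyond the corresponding face; radius one is taken. -/
theorem IsHyperrectangle.exists_exterior_ball (h : IsHyperrectangle Ω) :
    ∃ r > 0, ∀ p ∈ frontier Ω, ∃ y, dist p y = r ∧ Disjoint (ball y r) Ω := by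
  have hopen := h.isOpen
  obtain ⟨a, b, -, rfl⟩ := h
  refine ⟨1, one_pos, fun p hp => ?_⟩
  rw [hopen.frontier_eq] at hp
  have hp2 : ∃ i, ¬ p i ∈ Ioo (a i) (b i) := by simpa using hp.2
  obtain ⟨i, hi⟩ := hp2
  have hcoord : ∀ y x : EuclideanSpace ℝ (Fin N), x ∈ ball y 1 → |x i - y i| < 1 := by
    intro y x hx
    rw [mem_ball, dist_eq_norm] at hx
    exact (PiLp.norm_apply_le (x - y) i).trans_lt hx
  by_cases hai : p i ≤ a i
  · refine ⟨p - EuclideanSpace.single i 1, by simp, ?_⟩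
    rw [Set.disjoint_left]
    intro x hx hxΩ
    have h1 := (abs_lt.1 (hcoord _ x hx)).2
    have h2 := (hxΩ i).1
    simp at h1
    linarith
  · have hbi : b i ≤ p i := by
      by_contra! hlt
      exact hi ⟨not_le.1 hai, hlt⟩
    refine ⟨p + EuclideanSpace.single i 1, by simp, ?_⟩
    rw [Set.disjoint_left]
    intro x hx hxΩ
    have h1 := (abs_lt.1 (hcoord _ x hx)).1
    have h2 := (hxΩ i).2
    simp at h1
    linarith

/-- Near `p` the gradient `n` of `ρ` is Lipschitz with constant `K` and longer than `m`. A point `x`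
of `Ω` at distance `d` from `q` has `⟨n, x - q⟩ < K d²` by Taylor, while lying in the ball of radius
`r` tangent at `q` in direction `n` means `d² ‖n‖ < 2 r ⟨n, x - q⟩`. These are incompatible once `2
r (K + 1) ≤ m`. The radius is uniform in `q`, so that compactness of the boundary gives a global
one. -/
theorem exists_uniform_exterior_ball_of_contDiffOn {E : Type*} [NormedAddCommGroup E]
    [InnerProductSpace ℝ E] [CompleteSpace E] {U Ω : Set E} (hU : IsOpen U) {ρ : E → ℝ}
    (hρ : ContDiffOn ℝ 2 ρ U) {p : E} (hp : p ∈ U) (hne : fderiv ℝ ρ p ≠ 0)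
    (hΩ : ∀ x ∈ U, x ∈ Ω ↔ ρ x < 0) :
    ∃ t ∈ 𝓝 p, ∃ r₀ > 0, ∀ q ∈ t, q ∉ Ω → ∀ r, 0 < r → r ≤ r₀ →
      ∃ y, dist q y = r ∧ Disjoint (ball y r) Ω := by
  have hC : ContDiffAt ℝ 1 (fderiv ℝ ρ) p :=
    (hρ.contDiffAt (hU.mem_nhds hp)).fderiv_right (by norm_num)
  obtain ⟨K, t, ht, hK⟩ := hC.exists_lipschitzOnWith
  set m := ‖fderiv ℝ ρ p‖ / 2 with hm
  have hm0 : 0 < m := half_pos (norm_pos_iff.2 hne)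
  have hgrad : ∀ᶠ x in 𝓝 p, m < ‖fderiv ℝ ρ x‖ :=
    hC.continuousAt.norm.eventually (lt_mem_nhds (half_lt_self (norm_pos_iff.2 hne)))
  obtain ⟨η, hη, hsub⟩ := nhds_basis_closedBall.mem_iff.1
    (inter_mem (inter_mem ht (hU.mem_nhds hp)) hgrad)
  refine ⟨ball p (η / 2), ball_mem_nhds p (half_pos hη), min (η / 4) (m / (2 * (K + 1))),
    by positivity, fun q hq hqΩ r hr hr0 => ?_⟩
  have hr1 : r ≤ η / 4 := hr0.trans (min_le_left _ _)
  have hr2 : r * (2 * (K + 1)) ≤ m := by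
    rw [← le_div_iff₀ (by positivity)]
    exact hr0.trans (min_le_right _ _)
  have hqB : q ∈ closedBall p η := by
    rw [mem_ball] at hq
    rw [mem_closedBall]
    linarith
  have hqU : q ∈ U := (hsub hqB).1.2
  have hρq : 0 ≤ ρ q := by
    by_contra! h
    exact hqΩ ((hΩ q hqU).2 h)
  have hnm : m < ‖fderiv ℝ ρ q‖ := (hsub hqB).2
  set n : E := (InnerProductSpace.toDual ℝ E).symm (fderiv ℝ ρ q) with hn
  have hnn : ‖n‖ = ‖fderiv ℝ ρ q‖ := by simp [hn]
  have hin : ∀ x, inner ℝ n x = fderiv ℝ ρ q x := fun x => by simp [hn]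
  rw [← hnn] at hnm
  have hn0 : 0 < ‖n‖ := hm0.trans hnm
  refine ⟨q + (r / ‖n‖) • n, ?_, ?_⟩
  · rw [dist_eq_norm]
    simp only [sub_add_cancel_left, norm_neg, norm_smul, norm_div, Real.norm_eq_abs, abs_norm,
      abs_of_pos hr]
    field_simp
  rw [Set.disjoint_left]
  intro x hx hxΩ
  set d := ‖x - q‖ with hd
  have hsq : d ^ 2 * ‖n‖ < 2 * r * inner ℝ n (x - q) := by
    rw [mem_ball, dist_eq_norm] at hx
    have h1 : x - (q + (r / ‖n‖) • n) = (x - q) - (r / ‖n‖) • n := by abel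
    have h2 : ‖x - (q + (r / ‖n‖) • n)‖ ^ 2 < r ^ 2 := by gcongr
    rw [h1, norm_sub_sq_real, norm_smul, inner_smul_right, real_inner_comm, mul_pow, norm_div,
      norm_norm, Real.norm_eq_abs, abs_of_pos hr, ← hd, div_pow,
      div_mul_cancel₀ _ (by positivity)] at h2
    have h3 : d ^ 2 < 2 * (r / ‖n‖ * inner ℝ n (x - q)) := by linarith
    calc d ^ 2 * ‖n‖ < 2 * (r / ‖n‖ * inner ℝ n (x - q)) * ‖n‖ := by gcongr
      _ = 2 * r * inner ℝ n (x - q) := by field_simp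
  have hd2 : d ≤ η / 2 := by
    have h1 : dist x q ≤ dist x (q + (r / ‖n‖) • n) + dist (q + (r / ‖n‖) • n) q :=
      dist_triangle _ _ _
    have h2 : dist (q + (r / ‖n‖) • n) q = r := by
      rw [dist_eq_norm]
      simp only [add_sub_cancel_left, norm_smul, norm_div, Real.norm_eq_abs, abs_norm,
        abs_of_pos hr]
      field_simp
    rw [mem_ball] at hx
    rw [hd, ← dist_eq_norm]
    linarith
  have hballsub : closedBall q d ⊆ closedBall p η :=
    closedBall_subset_closedBall' (by rw [mem_ball] at hq; linarith)
  have hxd : x ∈ closedBall q d := by rw [mem_closedBall, dist_eq_norm]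
  have hqd : q ∈ closedBall q d := mem_closedBall_self (norm_nonneg _)
  have hmv : ‖ρ x - ρ q - fderiv ℝ ρ q (x - q)‖ ≤ K * d * ‖x - q‖ := by
    refine (convex_closedBall q d).norm_image_sub_le_of_norm_hasFDerivWithin_le' (f' := fderiv ℝ ρ)
      (fun z hz => ?_) (fun z hz => ?_) hqd hxd
    · exact ((hρ.contDiffAt (hU.mem_nhds (hsub (hballsub hz)).1.2)).differentiableAt
        (by simp)).hasFDerivAt.hasFDerivWithinAt
    · refine (hK.norm_sub_le (hsub (hballsub hz)).1.1 (hsub hqB).1.1).trans ?_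
      rw [mem_closedBall, dist_eq_norm] at hz
      gcongr
  rw [← hd, Real.norm_eq_abs] at hmv
  have h1 := (abs_le.1 hmv).1
  have h2 : ρ x < 0 := (hΩ x (hsub (hballsub hxd)).1.2).1 hxΩ
  rw [hin] at hsq
  have h3 : fderiv ℝ ρ q (x - q) < K * d * d := by linarith
  have h4 : 2 * r * fderiv ℝ ρ q (x - q) < 2 * r * (K * d * d) := by gcongr
  have h5 : d ^ 2 * (r * (2 * (K + 1))) ≤ d ^ 2 * ‖n‖ := by
    gcongr
    exact hr2.trans hnm.le
  nlinarith [mul_nonneg (sq_nonneg d) hr.le]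

theorem IsSmoothBoundedDomain.exists_exterior_ball (h : IsSmoothBoundedDomain Ω) :
    ∃ r > 0, ∀ p ∈ frontier Ω, ∃ y, dist p y = r ∧ Disjoint (ball y r) Ω := by
  have hcomp : IsCompact (frontier Ω) :=
    h.isBounded.isCompact_closure.of_isClosed_subset isClosed_frontier frontier_subset_closure
  obtain ⟨r₀, hr₀, hball⟩ := hcomp.induction_on
    (p := fun s => ∃ r₀ > 0, ∀ q ∈ s, q ∉ Ω → ∀ r, 0 < r → r ≤ r₀ →
      ∃ y, dist q y = r ∧ Disjoint (ball y r) Ω)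
    ⟨1, one_pos, by simp⟩
    (fun s t hst ⟨r, hr, hq⟩ => ⟨r, hr, fun q hqs => hq q (hst hqs)⟩)
    (fun s t ⟨r₁, hr₁, h₁⟩ ⟨r₂, hr₂, h₂⟩ => ⟨min r₁ r₂, lt_min hr₁ hr₂, fun q hq hqΩ r hr hle =>
      hq.elim (fun hs => h₁ q hs hqΩ r hr (hle.trans (min_le_left _ _)))
        (fun ht => h₂ q ht hqΩ r hr (hle.trans (min_le_right _ _)))⟩)
    (fun p hp => by
      obtain ⟨U, ρ, hU, hpU, hρ, hne, heq⟩ := h.smooth_boundary p hp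
      obtain ⟨t, ht, hr⟩ := exists_uniform_exterior_ball_of_contDiffOn hU
        (by exact_mod_cast contDiffOn_infty.1 hρ 2) hpU (hne p hpU) (Ω := Ω) (fun x hx => by
          have := Set.ext_iff.1 heq x
          simpa [hx] using this)
      exact ⟨t, mem_nhdsWithin_of_mem_nhds ht, hr⟩)
  refine ⟨r₀, hr₀, fun p hp => hball p hp (fun hpΩ => ?_) r₀ hr₀ le_rfl⟩
  rw [h.isOpen.frontier_eq] at hp
  exact hp.2 hpΩ

end ExteriorBall

/-! ### A priori bounds and the comparison principle for the system. -/

section Comparison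

open Laplacian InnerProductSpace Metric

variable {E : Type*} [NormedAddCommGroup E] [InnerProductSpace ℝ E] [FiniteDimensional ℝ E]

/-- A positive solution of `Δ² u - 2 κ Δ u = u - u³` in `Ω` with Navier boundary conditions, written
as the second order system for `u` and `v = -Δ u + κ u`, both extended by zero. -/
structure IsNavierPair (κ : ℝ) (Ω : Set E) (u v : E → ℝ) : Prop where
  continuous_fst : Continuous u
  continuous_snd : Continuous v
  fst_eq_zero : ∀ x ∉ Ω, u x = 0
  snd_eq_zero : ∀ x ∉ Ω, v x = 0
  contDiffOn_fst : ContDiffOn ℝ 2 u Ω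
  contDiffOn_snd : ContDiffOn ℝ 2 v Ω
  laplacian_fst : ∀ x ∈ Ω, Δ u x = κ * u x - v x
  laplacian_snd : ∀ x ∈ Ω, Δ v x = κ * v x - ((1 + κ ^ 2) * u x - u x ^ 3)
  pos : ∀ x ∈ Ω, 0 < u x

namespace IsNavierPair

variable {κ : ℝ} {Ω : Set E} {u v : E → ℝ}

theorem fst_nonneg (h : IsNavierPair κ Ω u v) (x : E) : 0 ≤ u x := by
  by_cases hx : x ∈ Ω
  · exact (h.pos x hx).le
  · exact (h.fst_eq_zero x hx).ge

/-- Let `M = max u` and let `s` be the value of `u` where `v` is maximal. The two maximum conditions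
give `κ² M ≤ κ max v ≤ (1 + κ²)s - s³`. As `s ≤ M`, this forces `s ≤ 1`; for `κ² ≥ 2` the cubic
increases on `[0, 1]`, so its value is at most `κ²` and `M ≤ 1`. -/
theorem fst_le_one (h : IsNavierPair κ Ω u v) (hΩ : IsOpen Ω) (hb : Bornology.IsBounded Ω)
    (hκ : 0 < κ) (hκ2 : 2 ≤ κ ^ 2) (x : E) : u x ≤ 1 := by
  by_contra! hx
  have hxΩ : x ∈ Ω := by
    by_contra hn
    rw [h.fst_eq_zero x hn] at hx
    linarith
  have hc := hb.isCompact_closure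
  have hne : (closure Ω).Nonempty := ⟨x, subset_closure hxΩ⟩
  obtain ⟨x₁, -, hmax₁⟩ := hc.exists_isMaxOn hne h.continuous_fst.continuousOn
  obtain ⟨x₂, -, hmax₂⟩ := hc.exists_isMaxOn hne h.continuous_snd.continuousOn
  have hM : 1 < u x₁ := hx.trans_le (hmax₁ (subset_closure hxΩ))
  have hx₁ : x₁ ∈ Ω := by
    by_contra hn
    rw [h.fst_eq_zero x₁ hn] at hM
    linarith
  have hcl : ∀ y ∈ Ω, closure Ω ∈ 𝓝 y := fun y hy => mem_of_superset (hΩ.mem_nhds hy) subset_closure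
  have h1 := (hmax₁.isLocalMax (hcl x₁ hx₁)).laplacian_nonpos
    (h.contDiffOn_fst.contDiffAt (hΩ.mem_nhds hx₁))
  rw [h.laplacian_fst x₁ hx₁] at h1
  have h2 : v x₁ ≤ v x₂ := hmax₂ (subset_closure hx₁)
  have hpos : 0 < κ * u x₁ := by positivity
  have hx₂ : x₂ ∈ Ω := by
    by_contra hn
    rw [h.snd_eq_zero x₂ hn] at h2
    linarith
  have h3 := (hmax₂.isLocalMax (hcl x₂ hx₂)).laplacian_nonpos
    (h.contDiffOn_snd.contDiffAt (hΩ.mem_nhds hx₂))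
  rw [h.laplacian_snd x₂ hx₂] at h3
  have h4 : u x₂ ≤ u x₁ := hmax₁ (subset_closure hx₂)
  have h5 := h.pos x₂ hx₂
  set s := u x₂
  set M := u x₁
  have h6 : κ ^ 2 * M ≤ (1 + κ ^ 2) * s - s ^ 3 := by
    have : κ * (κ * M) ≤ κ * v x₂ := mul_le_mul_of_nonneg_left (by linarith) hκ.le
    linarith
  have h7 : s ≤ 1 := by
    by_contra! hs
    have : κ ^ 2 * s ≤ κ ^ 2 * M := by gcongr
    nlinarith [mul_pos h5 (sub_pos.2 hs)]
  have h8 : κ ^ 2 * 1 < κ ^ 2 * M := by gcongr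
  nlinarith [mul_nonneg (sub_nonneg.2 h7) h5.le, mul_nonneg (sub_nonneg.2 h7) (sub_nonneg.2 hκ2),
    mul_nonneg (mul_nonneg (sub_nonneg.2 h7) h5.le) h5.le]

/-- At a negative minimum of `v`, the bound `u ≤ 1` makes the right-hand side positive, so that `Δv
< 0`. -/
theorem snd_nonneg (h : IsNavierPair κ Ω u v) (hΩ : IsOpen Ω) (hb : Bornology.IsBounded Ω)
    (hκ : 0 < κ) (hκ2 : 2 ≤ κ ^ 2) (x : E) : 0 ≤ v x := by
  by_contra! hx
  have hxΩ : x ∈ Ω := by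
    by_contra hn
    rw [h.snd_eq_zero x hn] at hx
    linarith
  obtain ⟨x₀, -, hmin⟩ := hb.isCompact_closure.exists_isMinOn ⟨x, subset_closure hxΩ⟩
    h.continuous_snd.continuousOn
  have hv : v x₀ < 0 := (hmin (subset_closure hxΩ)).trans_lt hx
  have hx₀ : x₀ ∈ Ω := by
    by_contra hn
    rw [h.snd_eq_zero x₀ hn] at hv
    linarith
  have h1 := (hmin.isLocalMin (mem_of_superset (hΩ.mem_nhds hx₀) subset_closure)).laplacian_nonneg
    (h.contDiffOn_snd.contDiffAt (hΩ.mem_nhds hx₀))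
  rw [h.laplacian_snd x₀ hx₀] at h1
  have h2 := h.fst_le_one hΩ hb hκ hκ2 x₀
  have h3 := h.pos x₀ hx₀
  have h4 : u x₀ ^ 2 ≤ 1 := pow_le_one₀ h3.le h2
  nlinarith [mul_nonneg h3.le (sub_nonneg.2 h4), mul_pos (mul_pos hκ hκ) h3, mul_pos_of_neg_of_neg
    hv (neg_neg_of_pos hκ)]

end IsNavierPair

/-- The width `1 / a` of the shell is the one on which the exponential stays above `exp (-1)`; the
factor `exp 1` in the choice of `a` compensates for this. -/
theorem exists_barrier_coeff (E : Type*) [NormedAddCommGroup E] [InnerProductSpace ℝ E]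
    [FiniteDimensional ℝ E] {r : ℝ} (hr : 0 < r) (B : ℝ) (hB : 0 ≤ B) :
    ∃ a > 0, ∀ x y : E, r ≤ ‖x - y‖ →
      0 ≤ Δ (fun x : E => Real.exp (a * (r ^ 2 - ‖x - y‖ ^ 2))) x ∧
      (‖x - y‖ ^ 2 ≤ r ^ 2 + 1 / a →
        B ≤ Δ (fun x : E => Real.exp (a * (r ^ 2 - ‖x - y‖ ^ 2))) x) := by
  set n : ℝ := (Module.finrank ℝ E : ℝ) with hn
  have hn0 : 0 ≤ n := Nat.cast_nonneg _
  set a := max 1 ((n + B * Real.exp 1) / r ^ 2) with ha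
  have ha1 : 1 ≤ a := le_max_left _ _
  have ha0 : 0 < a := by linarith
  have ha2 : n + B * Real.exp 1 ≤ a * r ^ 2 := by
    rw [← div_le_iff₀ (by positivity)]
    exact le_max_right _ _
  have hBe : 0 ≤ B * Real.exp 1 := by positivity
  refine ⟨a, ha0, fun x y hxy => ?_⟩
  rw [laplacian_exp_sub_norm_sq]
  have h1 : r ^ 2 ≤ ‖x - y‖ ^ 2 := by gcongr
  have h2 : B * Real.exp 1 ≤ 4 * a ^ 2 * ‖x - y‖ ^ 2 - 2 * a * n := by
    have h3 : a * (n + B * Real.exp 1) ≤ a * (a * r ^ 2) := by gcongr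
    nlinarith [mul_le_mul_of_nonneg_left h1 (by positivity : 0 ≤ 4 * a ^ 2),
      mul_le_mul_of_nonneg_right ha1 hBe, sq_nonneg (a * r)]
  refine ⟨mul_nonneg (hBe.trans h2) (Real.exp_pos _).le, fun h3 => ?_⟩
  have h4 : Real.exp (-1) ≤ Real.exp (a * (r ^ 2 - ‖x - y‖ ^ 2)) := by
    refine Real.exp_le_exp.2 ?_
    have : a * (‖x - y‖ ^ 2 - r ^ 2) ≤ a * (1 / a) := by
      gcongr
      linarith
    rw [mul_one_div_cancel ha0.ne'] at this
    linarith
  calc B = B * Real.exp 1 * Real.exp (-1) := by rw [mul_assoc, ← Real.exp_add]; simp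
    _ ≤ _ := mul_le_mul h2 h4 (Real.exp_pos _).le (hBe.trans h2)

/-- Comparison of a Navier pair with its image under an isometry `x ↦ A x + c`. The pair itself,
corrected by a barrier near `∂Ω`, is a strict supersolution of the linearized system. -/
theorem IsNavierPair.le_comp_isometry [Nontrivial E] {κ : ℝ} {Ω : Set E} {u v : E → ℝ}
    (h : IsNavierPair κ Ω u v) (hΩ : IsOpen Ω) (hb : Bornology.IsBounded Ω)
    (hκ : 0 < κ) (hκ2 : 2 ≤ κ ^ 2)
    (hext : ∃ r > 0, ∀ p ∈ frontier Ω, ∃ y, dist p y = r ∧ Disjoint (ball y r) Ω)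
    (A : E ≃ₗᵢ[ℝ] E) (c : E) {D : Set E} (hD : IsOpen D) (hDΩ : D ⊆ Ω)
    (hmap : ∀ x ∈ closure D, x ∈ Ω → A x + c ∈ Ω)
    (hfix : ∀ x ∈ frontier D, x ∈ Ω → A x + c = x) {x : E} (hx : x ∈ D) :
    u x ≤ u (A x + c) ∧ v x ≤ v (A x + c) := by
  obtain ⟨r, hr, hext⟩ := hext
  obtain ⟨a, ha, hlap⟩ := exists_barrier_coeff E hr (4 / κ * (1 + κ ^ 2)) (by positivity)
  have hu0 := h.fst_nonneg
  have hu1 := h.fst_le_one hΩ hb hκ hκ2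
  have hv0 := h.snd_nonneg hΩ hb hκ hκ2
  have hclD : closure D ⊆ closure Ω := closure_mono hDΩ
  have hcomp : IsCompact (closure D) := (hb.subset hDΩ).isCompact_closure
  have hRc : Continuous fun x => A x + c := A.continuous.add continuous_const
  have huR : Continuous fun x => u (A x + c) := h.continuous_fst.comp hRc
  have hvR : Continuous fun x => v (A x + c) := h.continuous_snd.comp hRc
  -- the centres of exterior balls and the distance to them
  set Y : Set E := {y | ∀ z ∈ Ω, r ≤ dist z y} with hY
  have hYdisj : ∀ y, Disjoint (ball y r) Ω → y ∈ Y := fun y hy z hz => by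
    by_contra! hlt
    exact Set.disjoint_left.1 hy (mem_ball.2 hlt) hz
  have hYclosed : IsClosed Y := by
    have : Y = ⋂ z ∈ Ω, {y | r ≤ dist z y} := by ext; simp [hY]
    rw [this]
    exact isClosed_biInter fun z _ => isClosed_le continuous_const (by fun_prop)
  -- Nontriviality of `E` provides points far from the bounded set `Ω`.
  have hYne : Y.Nonempty := by
    obtain ⟨C, hC⟩ := hb.exists_norm_le
    obtain ⟨y, hy⟩ := NormedSpace.exists_lt_norm ℝ E (C + r)
    refine ⟨y, fun z hz => ?_⟩
    have h1 := hC z hz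
    have h2 := norm_sub_norm_le y z
    rw [dist_comm, dist_eq_norm]
    linarith
  set s : E → ℝ := fun x => infDist x Y with hs
  have hsc : Continuous s := continuous_infDist_pt Y
  have hYcl : ∀ y ∈ Y, ∀ z ∈ closure Ω, r ≤ dist z y := fun y hy z hz =>
    closure_minimal (t := {z | r ≤ dist z y}) (fun z hz => hy z hz)
      (isClosed_le continuous_const (by fun_prop)) hz
  have hsr : ∀ z ∈ closure Ω, r ≤ s z := fun z hz =>
    (le_infDist hYne).2 fun y hy => hYcl y hy z hz
  have hsf : ∀ z ∈ frontier Ω, s z ≤ r := fun z hz => by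
    obtain ⟨y, hy, hyd⟩ := hext z hz
    exact hy ▸ infDist_le_dist_of_mem (hYdisj y hyd)
  -- The barrier lies between `κ / 4` and `κ` on `closure Ω`: positive, yet small enough for `-Δφ +
  -- κφ = v + κε > v + εg = ψ` in the first equation. Near `∂Ω`, where `s` is close to `r`, it is
  -- very superharmonic.
  set g : E → ℝ := fun x => κ / 4 * (2 - Real.exp (a * (r ^ 2 - s x ^ 2))) with hg
  have hgc : Continuous g := by fun_prop
  have hg1 : ∀ z ∈ closure Ω, κ / 4 ≤ g z := fun z hz => by
    have h1 : r ^ 2 ≤ s z ^ 2 := by gcongr; exact hsr z hz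
    have h2 : Real.exp (a * (r ^ 2 - s z ^ 2)) ≤ 1 := by
      rw [Real.exp_le_one_iff]
      nlinarith
    simp only [hg]
    nlinarith
  have hg2 : ∀ z, g z < κ := fun z => by
    have := Real.exp_pos (a * (r ^ 2 - s z ^ 2))
    simp only [hg]
    nlinarith
  -- the gain away from the boundary
  set G : E → ℝ := fun x => (u (A x + c) ^ 2 + u (A x + c) * u x) * u x with hG
  have hGc : Continuous G := by have := h.continuous_fst; fun_prop
  have hK : IsCompact (closure D ∩ {z | r ^ 2 + 1 / a ≤ s z ^ 2}) :=
    hcomp.inter_right (isClosed_le continuous_const (by fun_prop))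
  have hcase : ∀ z ∈ closure D, z ∉ Ω → z ∈ frontier Ω := fun z hz hzΩ => by
    rw [hΩ.frontier_eq]
    exact ⟨hclD hz, hzΩ⟩
  -- This set avoids `∂Ω`, where `s ≤ r`, so `u` is positive at each of its points and at the image
  -- point.
  have hGpos : ∀ z ∈ closure D ∩ {z | r ^ 2 + 1 / a ≤ s z ^ 2}, 0 < G z := by
    rintro z ⟨hz, hz2⟩
    have hzΩ : z ∈ Ω := by
      by_contra hzΩ
      have h1 := hsf z (hcase z hz hzΩ)
      have h2 : s z ^ 2 ≤ r ^ 2 := by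
        have : 0 ≤ s z := infDist_nonneg
        gcongr
      have h3 : 0 < 1 / a := by positivity
      simp only [mem_ofPred_eq] at hz2
      linarith
    have h1 := h.pos z hzΩ
    have h2 := h.pos _ (hmap z hz hzΩ)
    simp only [hG]
    positivity
  obtain ⟨δ, hδ, hGδ⟩ := hK.exists_forall_le' hGc.continuousOn hGpos
  -- Adding `ε` to `u` costs at most `kε ≤ (1 + κ²)ε` in the second equation; this must stay below
  -- the gain `δ`.
  set ε := δ / (2 * (1 + κ ^ 2)) with hε
  have hε0 : 0 < ε := by positivity
  have hεδ : (1 + κ ^ 2) * ε < δ := by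
    rw [hε]
    field_simp
    linarith
  set φ : E → ℝ := fun x => u x + ε with hφ
  set ψ : E → ℝ := fun x => v x + ε * g x with hψ
  have hφ0 : ∀ z, 0 < φ z := fun z => add_pos_of_nonneg_of_pos (hu0 z) hε0
  have hψ0 : ∀ z ∈ closure D, 0 < ψ z := fun z hz =>
    add_pos_of_nonneg_of_pos (hv0 z) (mul_pos hε0 (by linarith [hg1 z (hclD hz)]))
  have hφc : Continuous φ := by have := h.continuous_fst; fun_prop
  have hψc : Continuous ψ := by have := h.continuous_snd; fun_prop
  set U : E → ℝ := fun x => u (A x + c) - u x with hU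
  set V : E → ℝ := fun x => v (A x + c) - v x with hV
  have hUc : Continuous U := huR.sub h.continuous_fst
  have hVc : Continuous V := hvR.sub h.continuous_snd
  by_contra hcon
  have hQc : ContinuousOn (fun x => min (U x / φ x) (V x / ψ x)) (closure D) :=
    (hUc.continuousOn.div hφc.continuousOn fun z _ => (hφ0 z).ne').inf
      (hVc.continuousOn.div hψc.continuousOn fun z hz => (hψ0 z hz).ne')
  obtain ⟨x₀, hx₀, hmin⟩ := hcomp.exists_isMinOn ⟨x, subset_closure hx⟩ hQc
  -- The least multiple of `(φ, ψ)` that lifts both `U` and `V` to nonnegative functions; one of the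
  -- lifted functions vanishes at `x₀`.
  set t := -min (U x₀ / φ x₀) (V x₀ / ψ x₀) with ht
  have ht0 : 0 < t := by
    have h1 : min (U x₀ / φ x₀) (V x₀ / ψ x₀) ≤ min (U x / φ x) (V x / ψ x) :=
      hmin (subset_closure hx)
    have h2 : min (U x / φ x) (V x / ψ x) < 0 := by
      rw [not_and_or, not_le, not_le] at hcon
      rw [min_lt_iff]
      rcases hcon with hcon | hcon
      · exact Or.inl (div_neg_of_neg_of_pos (sub_neg.2 hcon) (hφ0 x))
      · exact Or.inr (div_neg_of_neg_of_pos (sub_neg.2 hcon) (hψ0 x (subset_closure hx)))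
    linarith
  have hUt : ∀ z ∈ closure D, 0 ≤ U z + t * φ z := fun z hz => by
    have h1 : -t ≤ min (U z / φ z) (V z / ψ z) := by rw [ht, neg_neg]; exact hmin hz
    have h2 := (le_div_iff₀ (hφ0 z)).1 (h1.trans (min_le_left _ _))
    linarith
  have hVt : ∀ z ∈ closure D, 0 ≤ V z + t * ψ z := fun z hz => by
    have h1 : -t ≤ min (U z / φ z) (V z / ψ z) := by rw [ht, neg_neg]; exact hmin hz
    have h2 := (le_div_iff₀ (hψ0 z hz)).1 (h1.trans (min_le_right _ _))
    linarith
  have hor : U x₀ + t * φ x₀ = 0 ∨ V x₀ + t * ψ x₀ = 0 := by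
    rcases min_choice (U x₀ / φ x₀) (V x₀ / ψ x₀) with hc | hc
    · left
      rw [ht, hc]
      have := (hφ0 x₀).ne'
      field_simp
      ring
    · right
      rw [ht, hc]
      have := (hψ0 x₀ hx₀).ne'
      field_simp
      ring
  have hφt := mul_pos ht0 (hφ0 x₀)
  have hψt := mul_pos ht0 (hψ0 x₀ hx₀)
  -- On the part of the frontier fixed by the isometry `U = V = 0`; outside `Ω` the pair vanishes
  -- and its image is nonnegative. In both cases the strictly positive lift prevents contact.
  have hx₀D : x₀ ∈ D := by
    by_contra hnD
    have hfr : x₀ ∈ frontier D := by rw [hD.frontier_eq]; exact ⟨hx₀, hnD⟩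
    have hUV : 0 ≤ U x₀ ∧ 0 ≤ V x₀ := by
      by_cases hxΩ : x₀ ∈ Ω
      · simp [hU, hV, hfix x₀ hfr hxΩ]
      · simp [hU, hV, h.fst_eq_zero x₀ hxΩ, h.snd_eq_zero x₀ hxΩ, hu0, hv0]
    rcases hor with hc | hc <;> linarith [hUV.1, hUV.2]
  have hx₀Ω := hDΩ hx₀D
  have hRx₀ := hmap x₀ hx₀ hx₀Ω
  have hcl : closure D ∈ 𝓝 x₀ := mem_of_superset (hD.mem_nhds hx₀D) subset_closure
  have hR2 : ContDiffAt ℝ 2 (fun x => A x + c) x₀ := (A.contDiff.add contDiff_const).contDiffAt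
  have hu2 := h.contDiffOn_fst.contDiffAt (hΩ.mem_nhds hx₀Ω)
  have hv2 := h.contDiffOn_snd.contDiffAt (hΩ.mem_nhds hx₀Ω)
  have hu2' := h.contDiffOn_fst.contDiffAt (hΩ.mem_nhds hRx₀)
  have hv2' := h.contDiffOn_snd.contDiffAt (hΩ.mem_nhds hRx₀)
  have huR2 : ContDiffAt ℝ 2 (fun x => u (A x + c)) x₀ := hu2'.comp x₀ hR2
  have hvR2 : ContDiffAt ℝ 2 (fun x => v (A x + c)) x₀ := hv2'.comp x₀ hR2
  have hU2 : ContDiffAt ℝ 2 U x₀ := huR2.sub hu2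
  have hV2 : ContDiffAt ℝ 2 V x₀ := hvR2.sub hv2
  have hlapU : Δ U x₀ = κ * U x₀ - V x₀ := by
    have h1 : Δ U x₀ = Δ (fun x => u (A x + c)) x₀ - Δ u x₀ := huR2.laplacian_sub hu2
    rw [h1, laplacian_comp_isometry A c hu2', h.laplacian_fst _ hRx₀, h.laplacian_fst _ hx₀Ω]
    simp only [hU, hV]
    ring
  have hlapV : Δ V x₀ = κ * V x₀ -
      ((1 + κ ^ 2) - (u (A x₀ + c) ^ 2 + u (A x₀ + c) * u x₀ + u x₀ ^ 2)) * U x₀ := by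
    have h1 : Δ V x₀ = Δ (fun x => v (A x + c)) x₀ - Δ v x₀ := hvR2.laplacian_sub hv2
    rw [h1, laplacian_comp_isometry A c hv2', h.laplacian_snd _ hRx₀, h.laplacian_snd _ hx₀Ω]
    simp only [hU, hV]
    ring
  rcases hor with hc | hc
  · have hloc : IsLocalMin (U + t • (u + fun _ => ε)) x₀ := by
      filter_upwards [hcl] with z hz
      exact hc.trans_le (hUt z hz)
    have hue : ContDiffAt ℝ 2 (u + fun _ => ε) x₀ := hu2.add contDiffAt_const
    have htue : ContDiffAt ℝ 2 (t • (u + fun _ => ε)) x₀ := hue.const_smul t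
    have hnn := hloc.laplacian_nonneg (hU2.add htue)
    rw [hU2.laplacian_add htue, laplacian_smul t hue,
      hu2.laplacian_add contDiffAt_const, laplacian_const, hlapU, h.laplacian_fst _ hx₀Ω] at hnn
    have h1 := hVt x₀ hx₀
    simp only [Pi.zero_apply, add_zero, smul_eq_mul] at hnn
    simp only [hφ, hψ] at hc h1
    have h2 : t * ε * g x₀ < t * ε * κ := mul_lt_mul_of_pos_left (hg2 x₀) (by positivity)
    have h3 : κ * U x₀ = -(κ * (t * (u x₀ + ε))) := by
      rw [← mul_neg, ← eq_neg_of_add_eq_zero_left hc]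
    rw [h3] at hnn
    linarith
  -- The distance `s` need not be smooth. Replacing it by the distance to one nearest centre `y`
  -- gives a smooth function above `g`, equal to it at `x₀`, so `x₀` remains a local minimum.
  · obtain ⟨y, hyY, hy⟩ := hYclosed.exists_infDist_eq_dist hYne x₀
    set b : E → ℝ := fun x => Real.exp (a * (r ^ 2 - ‖x - y‖ ^ 2)) with hbdef
    have hbC : ContDiffAt ℝ 2 b x₀ := (contDiff_exp_sub_norm_sq a (r ^ 2) y (n := 2)).contDiffAt
    have hsx₀ : s x₀ = ‖x₀ - y‖ := by rw [← dist_eq_norm]; exact hy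
    have hgb : ∀ z, g z ≤ κ / 4 * (2 - b z) := fun z => by
      have h1 : s z ^ 2 ≤ ‖z - y‖ ^ 2 := by
        rw [← dist_eq_norm]
        have : 0 ≤ s z := infDist_nonneg
        gcongr
        exact infDist_le_dist_of_mem hyY
      have h2 : b z ≤ Real.exp (a * (r ^ 2 - s z ^ 2)) := by
        refine Real.exp_le_exp.2 ?_
        gcongr
      simp only [hg]
      gcongr
    have hgb0 : g x₀ = κ / 4 * (2 - b x₀) := by simp only [hg, hbdef, hsx₀]
    set w : E → ℝ := v + ε • (κ / 4) • ((fun _ => 2) - b) with hw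
    have hb2 : ContDiffAt ℝ 2 ((fun _ => 2) - b) x₀ := contDiffAt_const.sub hbC
    have hb3 : ContDiffAt ℝ 2 ((κ / 4) • ((fun _ => 2) - b)) x₀ := hb2.const_smul (κ / 4)
    have hb4 : ContDiffAt ℝ 2 (ε • (κ / 4) • ((fun _ => 2) - b)) x₀ := hb3.const_smul ε
    have hw2 : ContDiffAt ℝ 2 w x₀ := hv2.add hb4
    have hwlap : Δ w x₀ = Δ v x₀ - ε * (κ / 4 * Δ b x₀) := by
      rw [hw, hv2.laplacian_add hb4, laplacian_smul ε hb3, laplacian_smul _ hb2,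
        contDiffAt_const.laplacian_sub hbC, laplacian_const]
      simp
      ring
    have hloc : IsLocalMin (V + t • w) x₀ := by
      filter_upwards [hcl] with z hz
      have h1 : V x₀ + t * (v x₀ + ε * (κ / 4 * (2 - b x₀))) = 0 := by rw [← hgb0]; exact hc
      have h2 : V z + t * (v z + ε * g z) ≤ V z + t * (v z + ε * (κ / 4 * (2 - b z))) := by
        gcongr
        exact hgb z
      exact h1.trans_le ((hVt z hz).trans h2)
    have htw : ContDiffAt ℝ 2 (t • w) x₀ := hw2.const_smul t
    have hnn := hloc.laplacian_nonneg (hV2.add htw)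
    rw [hV2.laplacian_add htw, laplacian_smul t hw2, hwlap,
      hlapV, h.laplacian_snd _ hx₀Ω, smul_eq_mul] at hnn
    set p := u x₀ with hp
    set q := u (A x₀ + c) with hq
    set k := (1 + κ ^ 2) - (q ^ 2 + q * p + p ^ 2) with hk
    have hp0 : 0 ≤ p := hu0 _
    have hq0 : 0 ≤ q := hu0 _
    have hp1 : p ≤ 1 := hu1 _
    have hq1 : q ≤ 1 := hu1 _
    have hk0 : 0 ≤ k := by
      have h1 : q ^ 2 ≤ 1 := pow_le_one₀ hq0 hq1
      have h2 : p ^ 2 ≤ 1 := pow_le_one₀ hp0 hp1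
      have h3 : q * p ≤ 1 := mul_le_one₀ hq1 hp0 hp1
      linarith
    have hk1 : k ≤ 1 + κ ^ 2 := by
      have : 0 ≤ q ^ 2 + q * p + p ^ 2 := by positivity
      linarith
    have h1 : 0 ≤ k * (U x₀ + t * (p + ε)) := mul_nonneg hk0 (hUt x₀ hx₀)
    have h2 : κ * V x₀ = -(κ * (t * (v x₀ + ε * g x₀))) := by
      rw [← mul_neg, ← eq_neg_of_add_eq_zero_left hc]
    -- The second-order condition for `V + t w`, with `kU ≥ -tkφ` from cooperativity. The only
    -- positive term left is `kε`.
    have hfinal : 0 ≤ t * (-(κ * ε * g x₀) - G x₀ + k * ε - ε * (κ / 4 * Δ b x₀)) := by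
      have hG0 : G x₀ = (q ^ 2 + q * p) * p := rfl
      rw [hG0]
      rw [h2] at hnn
      have : t * (-(κ * ε * g x₀) - (q ^ 2 + q * p) * p + k * ε - ε * (κ / 4 * Δ b x₀)) =
          -(κ * (t * (v x₀ + ε * g x₀))) - k * U x₀ +
          t * (κ * v x₀ - ((1 + κ ^ 2) * p - p ^ 3) - ε * (κ / 4 * Δ b x₀)) +
          k * (U x₀ + t * (p + ε)) := by
        rw [hk]
        ring
      linarith
    have hfinal2 := nonneg_of_mul_nonneg_right hfinal ht0
    have hg0 : 0 < κ * ε * g x₀ := by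
      have := hg1 x₀ (subset_closure hx₀Ω)
      have : 0 < g x₀ := by linarith
      positivity
    obtain ⟨hl1, hl2⟩ := hlap x₀ y (hsx₀ ▸ hsr x₀ (subset_closure hx₀Ω))
    rw [← hbdef] at hl1 hl2
    have hkε : k * ε ≤ (1 + κ ^ 2) * ε := by gcongr
    -- Away from the boundary `G ≥ δ` beats `kε`; in the shell near it, the barrier term does.
    by_cases hnear : r ^ 2 + 1 / a ≤ s x₀ ^ 2
    · have h3 := hGδ x₀ ⟨hx₀, hnear⟩
      have h4 : 0 ≤ ε * (κ / 4 * Δ b x₀) := by positivity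
      linarith
    · have h3 := hl2 (by rw [← hsx₀]; linarith)
      have h4 : 0 ≤ G x₀ := by simp only [hG]; positivity
      have h5 : ε * (κ / 4 * (4 / κ * (1 + κ ^ 2))) ≤ ε * (κ / 4 * Δ b x₀) := by gcongr
      have h6 : ε * (κ / 4 * (4 / κ * (1 + κ ^ 2))) = (1 + κ ^ 2) * ε := by
        field_simp
      linarith

end Comparison

/-! ### Reduction of the fourth-order equation to the system. -/

section Extension

open Laplacian InnerProductSpace

theorem continuous_indicator_of_tendsto_frontier {X : Type*} [TopologicalSpace X] {Ω : Set X}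
    (hΩ : IsOpen Ω) {f : X → ℝ} (hf : ContinuousOn f Ω)
    (h0 : ∀ y ∈ frontier Ω, Tendsto f (𝓝[Ω] y) (𝓝 0)) : Continuous (Ω.indicator f) := by
  rw [continuous_iff_continuousAt]
  intro x
  by_cases hx : x ∈ Ω
  · refine (hf.continuousAt (hΩ.mem_nhds hx)).congr ?_
    filter_upwards [hΩ.mem_nhds hx] with y hy
    rw [indicator_of_mem hy]
  · rw [ContinuousAt, indicator_of_notMem hx, ← nhdsWithin_univ, ← union_compl_self Ω,
      nhdsWithin_union, tendsto_sup]
    constructor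
    · have h1 : Tendsto f (𝓝[Ω] x) (𝓝 0) := by
        by_cases hc : x ∈ closure Ω
        · exact h0 x (by rw [hΩ.frontier_eq]; exact ⟨hc, hx⟩)
        · rw [mem_closure_iff_nhdsWithin_neBot, not_neBot] at hc
          rw [hc]
          exact tendsto_bot
      refine h1.congr' ?_
      filter_upwards [self_mem_nhdsWithin] with y hy
      rw [indicator_of_mem hy]
    · refine tendsto_const_nhds.congr' ?_
      filter_upwards [self_mem_nhdsWithin] with y hy
      rw [indicator_of_notMem hy]

variable {E : Type*} [NormedAddCommGroup E] [InnerProductSpace ℝ E] [FiniteDimensional ℝ E]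

theorem ContDiffAt.laplacian {f : E → ℝ} {x : E} {m n : WithTop ℕ∞} (hf : ContDiffAt ℝ n f x)
    (hmn : m + 2 ≤ n) : ContDiffAt ℝ m (Δ f) x := by
  rw [laplacian_eq_iteratedFDeriv_stdOrthonormalBasis]
  refine ContDiffAt.sum fun i _ => ?_
  exact (ContinuousMultilinearMap.apply ℝ (fun _ : Fin 2 => E) ℝ
    ![stdOrthonormalBasis ℝ E i, stdOrthonormalBasis ℝ E i]).contDiff.contDiffAt.comp x
    (hf.iteratedFDeriv_right hmn)

theorem IsClassicalSolution.isNavierPair {N : ℕ} {β : ℝ} {Ω : Set (EuclideanSpace ℝ (Fin N))}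
    {u : EuclideanSpace ℝ (Fin N) → ℝ} (hu : IsClassicalSolution β Ω u) (hΩ : IsOpen Ω)
    (hpos : ∀ x ∈ Ω, 0 < u x) :
    IsNavierPair (β / 2) Ω (Ω.indicator u) (Ω.indicator ((β / 2) • u - Δ u)) := by
  have hu4 : ∀ x ∈ Ω, ContDiffAt ℝ 4 u x := fun x hx => hu.contDiffOn.contDiffAt (hΩ.mem_nhds hx)
  have hu2 : ∀ x ∈ Ω, ContDiffAt ℝ 2 u x := fun x hx => (hu4 x hx).of_le (by norm_num)
  have hΔ2 : ∀ x ∈ Ω, ContDiffAt ℝ 2 (Δ u) x := fun x hx => (hu4 x hx).laplacian (by norm_num)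
  have hsu2 : ∀ x ∈ Ω, ContDiffAt ℝ 2 ((β / 2) • u) x := fun x hx => (hu2 x hx).const_smul (β / 2)
  have hv2 : ∀ x ∈ Ω, ContDiffAt ℝ 2 ((β / 2) • u - Δ u) x := fun x hx =>
    (hsu2 x hx).sub (hΔ2 x hx)
  have hind : ∀ (f : EuclideanSpace ℝ (Fin N) → ℝ), ∀ x ∈ Ω, Ω.indicator f =ᶠ[𝓝 x] f :=
    fun f x hx => by
      filter_upwards [hΩ.mem_nhds hx] with y hy
      rw [indicator_of_mem hy]
  have hlap : ∀ (f : EuclideanSpace ℝ (Fin N) → ℝ), ∀ x ∈ Ω, Δ (Ω.indicator f) x = Δ f x :=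
    fun f x hx => (laplacian_congr_nhds (hind f x hx)).eq_of_nhds
  refine ⟨?_, ?_, fun x hx => indicator_of_notMem hx _, fun x hx => indicator_of_notMem hx _,
    fun x hx => ((hu2 x hx).congr_of_eventuallyEq (hind _ x hx)).contDiffWithinAt,
    fun x hx => ((hv2 x hx).congr_of_eventuallyEq (hind _ x hx)).contDiffWithinAt,
    fun x hx => ?_, fun x hx => ?_, fun x hx => by rw [indicator_of_mem hx]; exact hpos x hx⟩
  · exact continuous_indicator_of_tendsto_frontier hΩ hu.contDiffOn.continuousOn hu.boundary_value
  · refine continuous_indicator_of_tendsto_frontier hΩ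
      (fun x hx => (hv2 x hx).continuousAt.continuousWithinAt) fun y hy => ?_
    have : Tendsto ((β / 2) • u - Δ u) (𝓝[Ω] y) (𝓝 (β / 2 * 0 - 0)) :=
      ((hu.boundary_value y hy).const_mul (β / 2)).sub (hu.boundary_laplacian y hy)
    rwa [mul_zero, sub_zero] at this
  · rw [hlap u x hx, indicator_of_mem hx, indicator_of_mem hx]
    simp
  · rw [hlap _ x hx, indicator_of_mem hx, indicator_of_mem hx,
      (hsu2 x hx).laplacian_sub (hΔ2 x hx), laplacian_smul _ (hu2 x hx)]
    have := hu.equation x hx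
    simp only [Pi.sub_apply, Pi.smul_apply, smul_eq_mul]
    linarith

end Extension

/-! ### Reflections in the first coordinate: symmetry and monotonicity. -/

section Reflection

open Laplacian InnerProductSpace Metric

variable {N : ℕ} [NeZero N]

/-- The linear reflection `(x₁, x₂, …, x_N) ↦ (-x₁, x₂, …, x_N)`. -/
noncomputable def reflFirst (N : ℕ) [NeZero N] :
    EuclideanSpace ℝ (Fin N) ≃ₗᵢ[ℝ] EuclideanSpace ℝ (Fin N) :=
  LinearIsometryEquiv.piLpCongrRight 2 fun i : Fin N =>
    if i = 0 then LinearIsometryEquiv.neg ℝ else LinearIsometryEquiv.refl ℝ ℝ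

theorem withFirst_apply (x : EuclideanSpace ℝ (Fin N)) (s : ℝ) (i : Fin N) :
    withFirst x s i = if i = 0 then s else x i := by
  simp [withFirst, Function.update_apply]

theorem reflFirst_apply (x : EuclideanSpace ℝ (Fin N)) (i : Fin N) :
    reflFirst N x i = if i = 0 then -x i else x i := by
  simp only [reflFirst, LinearIsometryEquiv.piLpCongrRight_apply]
  split_ifs <;> simp

theorem reflFirst_add_eq_withFirst (x : EuclideanSpace ℝ (Fin N)) (l : ℝ) :
    reflFirst N x + EuclideanSpace.single 0 (2 * l) = withFirst x (2 * l - x 0) := by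
  ext i
  rw [PiLp.add_apply, reflFirst_apply, withFirst_apply]
  by_cases hi : i = 0
  · subst hi
    simp
    ring
  · simp [hi]

theorem withFirst_withFirst (x : EuclideanSpace ℝ (Fin N)) (s t : ℝ) :
    withFirst (withFirst x s) t = withFirst x t := by
  ext i
  simp only [withFirst_apply]
  split_ifs <;> rfl

theorem withFirst_self (x : EuclideanSpace ℝ (Fin N)) : withFirst x (x 0) = x := by
  ext i
  rw [withFirst_apply]
  split_ifs with hi
  · rw [hi]
  · rfl

theorem withFirst_zero_apply (x : EuclideanSpace ℝ (Fin N)) (s : ℝ) : withFirst x s 0 = s := by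
  simp [withFirst_apply]

theorem withFirst_eq_add (x : EuclideanSpace ℝ (Fin N)) (s : ℝ) :
    withFirst x s = x + (s - x 0) • EuclideanSpace.single 0 1 := by
  ext i
  rw [withFirst_apply]
  by_cases hi : i = 0
  · subst hi
    simp
  · simp [hi]

theorem continuous_withFirst (x : EuclideanSpace ℝ (Fin N)) : Continuous (withFirst x) := by
  rw [funext (withFirst_eq_add x)]
  fun_prop

theorem IsConvexSymmFirst.withFirst_mem {Ω : Set (EuclideanSpace ℝ (Fin N))}
    (h : IsConvexSymmFirst Ω) {x : EuclideanSpace ℝ (Fin N)} (hx : x ∈ Ω) {s : ℝ}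
    (hs : |s| ≤ |x 0|) : withFirst x s ∈ Ω := by
  by_cases h0 : x 0 = 0
  · have : s = x 0 := by
      rw [h0, abs_zero] at hs
      rw [h0, abs_nonpos_iff.1 hs]
    rwa [this, withFirst_self]
  · have h1 := h x hx (s / x 0) (mem_Icc.2 (abs_le.1 (by
      rw [abs_div]
      exact div_le_one_of_le₀ hs (abs_nonneg _))))
    rwa [div_mul_cancel₀ _ h0] at h1

namespace IsNavierPair

variable {κ : ℝ} {Ω : Set (EuclideanSpace ℝ (Fin N))} {u v : EuclideanSpace ℝ (Fin N) → ℝ}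

/-- A Navier pair on an open cap `{x ∈ Ω | l < x₁}` increases under reflection across
`{x₁ = l}`, for `l ≥ 0`. -/
theorem le_reflection (h : IsNavierPair κ Ω u v) (hΩ : IsOpen Ω) (hb : Bornology.IsBounded Ω)
    (hκ : 0 < κ) (hκ2 : 2 ≤ κ ^ 2)
    (hext : ∃ r > 0, ∀ p ∈ frontier Ω, ∃ y, dist p y = r ∧ Disjoint (ball y r) Ω)
    (hsymm : IsConvexSymmFirst Ω) {l : ℝ} (hl : 0 ≤ l) {x : EuclideanSpace ℝ (Fin N)}
    (hx : x ∈ Ω) (hlx : l < x 0) :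
    u x ≤ u (withFirst x (2 * l - x 0)) ∧ v x ≤ v (withFirst x (2 * l - x 0)) := by
  have hopen : IsOpen {x : EuclideanSpace ℝ (Fin N) | l < x 0} :=
    isOpen_lt continuous_const (by fun_prop)
  have hcl : closure (Ω ∩ {x | l < x 0}) ⊆ {x : EuclideanSpace ℝ (Fin N) | l ≤ x 0} :=
    closure_minimal (fun z hz => (show l < z 0 from hz.2).le) (isClosed_le continuous_const (by fun_prop))
  have hD := hΩ.inter hopen
  have := h.le_comp_isometry hΩ hb hκ hκ2 hext (reflFirst N) (EuclideanSpace.single 0 (2 * l))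
    hD inter_subset_left (fun z hz hzΩ => ?_) (fun z hz hzΩ => ?_) ⟨hx, hlx⟩
  · rwa [reflFirst_add_eq_withFirst] at this
  · rw [reflFirst_add_eq_withFirst]
    have h1 : l ≤ z 0 := hcl hz
    refine hsymm.withFirst_mem hzΩ ?_
    rw [abs_le, abs_of_nonneg (hl.trans h1)]
    constructor <;> linarith
  · rw [reflFirst_add_eq_withFirst]
    rw [hD.frontier_eq] at hz
    have h1 : l ≤ z 0 := hcl hz.1
    have h2 : z 0 = l := le_antisymm (not_lt.1 fun hlt => hz.2 ⟨hzΩ, hlt⟩) h1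
    rw [← h2, two_mul, add_sub_cancel_right, withFirst_self]

/-- The comparison is applied with `D = Ω`, whose frontier does not meet `Ω`, so no fixed points are
needed. Since the reflection is an involution, the inequality at `x` and at its image gives
equality. -/
theorem eq_withFirst_neg (h : IsNavierPair κ Ω u v) (hΩ : IsOpen Ω) (hb : Bornology.IsBounded Ω)
    (hκ : 0 < κ) (hκ2 : 2 ≤ κ ^ 2)
    (hext : ∃ r > 0, ∀ p ∈ frontier Ω, ∃ y, dist p y = r ∧ Disjoint (ball y r) Ω)
    (hsymm : IsConvexSymmFirst Ω) {x : EuclideanSpace ℝ (Fin N)} (hx : x ∈ Ω) :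
    u x = u (withFirst x (-x 0)) := by
  have hmem : ∀ z ∈ Ω, withFirst z (-z 0) ∈ Ω := fun z hz =>
    hsymm.withFirst_mem hz (abs_neg _).le
  have heq : ∀ z, reflFirst N z + EuclideanSpace.single 0 (2 * 0) = withFirst z (-z 0) := fun z => by
    rw [reflFirst_add_eq_withFirst, mul_zero, zero_sub]
  have hle : ∀ z ∈ Ω, u z ≤ u (withFirst z (-z 0)) := fun z hz => by
    rw [← heq]
    refine (h.le_comp_isometry hΩ hb hκ hκ2 hext (reflFirst N) (EuclideanSpace.single 0 (2 * 0))
      hΩ subset_rfl (fun z _ hzΩ => ?_) (fun z hz hzΩ => ?_) hz).1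
    · rw [heq]
      exact hmem z hzΩ
    · rw [hΩ.frontier_eq] at hz
      exact absurd hzΩ hz.2
  refine le_antisymm (hle x hx) ?_
  have := hle _ (hmem x hx)
  rwa [withFirst_withFirst, withFirst_zero_apply, neg_neg, withFirst_self] at this

/-- The difference `u(xˡ) - u(x)` on the cap `{x ∈ Ω | l < x₁}`. -/
theorem laplacian_reflection_sub (h : IsNavierPair κ Ω u v) (hΩ : IsOpen Ω) (l : ℝ)
    {x : EuclideanSpace ℝ (Fin N)} (hx : x ∈ Ω) (hRx : withFirst x (2 * l - x 0) ∈ Ω) :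
    ContDiffAt ℝ 2 (fun y => u (reflFirst N y + EuclideanSpace.single 0 (2 * l)) - u y) x ∧
    Δ (fun y => u (reflFirst N y + EuclideanSpace.single 0 (2 * l)) - u y) x =
      κ * (u (withFirst x (2 * l - x 0)) - u x) - (v (withFirst x (2 * l - x 0)) - v x) := by
  rw [← reflFirst_add_eq_withFirst] at hRx ⊢
  have hR2 : ContDiffAt ℝ 2
      (fun x => reflFirst N x + EuclideanSpace.single (0 : Fin N) (2 * l)) x :=
    ((reflFirst N).contDiff.add contDiff_const).contDiffAt
  have hu2 := h.contDiffOn_fst.contDiffAt (hΩ.mem_nhds hx)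
  have hu2' := h.contDiffOn_fst.contDiffAt (hΩ.mem_nhds hRx)
  have huR2 : ContDiffAt ℝ 2
      (fun x => u (reflFirst N x + EuclideanSpace.single (0 : Fin N) (2 * l))) x :=
    hu2'.comp x hR2
  refine ⟨huR2.sub hu2, (huR2.laplacian_sub hu2).trans ?_⟩
  rw [laplacian_comp_isometry _ _ hu2', h.laplacian_fst _ hRx, h.laplacian_fst _ hx]
  ring

/-- Equality at one point would spread, by the strong maximum principle, along the ray in direction
`e₁` to its exit point from `Ω`. There `u = 0`, but the reflected point is inside `Ω`, where `u >
0`. -/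
theorem lt_reflection (h : IsNavierPair κ Ω u v) (hΩ : IsOpen Ω) (hb : Bornology.IsBounded Ω)
    (hκ : 0 < κ) (hκ2 : 2 ≤ κ ^ 2)
    (hext : ∃ r > 0, ∀ p ∈ frontier Ω, ∃ y, dist p y = r ∧ Disjoint (ball y r) Ω)
    (hsymm : IsConvexSymmFirst Ω) {l : ℝ} (hl : 0 < l) {x : EuclideanSpace ℝ (Fin N)}
    (hx : x ∈ Ω) (hlx : l < x 0) : u x < u (withFirst x (2 * l - x 0)) := by
  have hle := fun z hz hlz => h.le_reflection hΩ hb hκ hκ2 hext hsymm hl.le (x := z) hz hlz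
  refine lt_of_le_of_ne (hle x hx hlx).1 fun heq => ?_
  set γ := withFirst x with hγ
  have hγc : Continuous γ := continuous_withFirst x
  -- the first exit parameter of the ray from `x` in the direction `e₁`
  set T : Set ℝ := {t | x 0 ≤ t ∧ γ t ∉ Ω} with hT
  have hTclosed : IsClosed T :=
    isClosed_Ici.inter (hΩ.isClosed_compl.preimage hγc)
  have hTne : T.Nonempty := by
    obtain ⟨C, hC⟩ := hb.exists_norm_le
    refine ⟨max (x 0) (C + 1), le_max_left _ _, fun hmem => ?_⟩
    have h1 := (PiLp.norm_apply_le (γ (max (x 0) (C + 1))) 0).trans (hC _ hmem)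
    rw [withFirst_zero_apply, Real.norm_eq_abs] at h1
    linarith [le_abs_self (max (x 0) (C + 1)), le_max_right (x 0) (C + 1)]
  have hTbdd : BddBelow T := ⟨x 0, fun t ht => ht.1⟩
  set b := sInf T with hbdef
  have hbT : b ∈ T := hTclosed.csInf_mem hTne hTbdd
  have hlt : ∀ t, x 0 ≤ t → t < b → γ t ∈ Ω := fun t h1 h2 => by
    by_contra hn
    exact absurd (csInf_le hTbdd ⟨h1, hn⟩) (not_le.2 h2)
  have hxb : x 0 < b := lt_of_le_of_ne hbT.1 fun he => by
    have := hbT.2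
    rw [← he, hγ, withFirst_self] at this
    exact this hx
  set U : EuclideanSpace ℝ (Fin N) → ℝ :=
    fun y => u (reflFirst N y + EuclideanSpace.single 0 (2 * l)) - u y with hU
  have hUc : Continuous U :=
    (h.continuous_fst.comp ((reflFirst N).continuous.add continuous_const)).sub h.continuous_fst
  have hUx : ∀ z, U z = u (withFirst z (2 * l - z 0)) - u z := fun z => by
    simp only [hU, reflFirst_add_eq_withFirst]
  have hO : IsOpen (Ω ∩ {x : EuclideanSpace ℝ (Fin N) | l < x 0}) :=
    hΩ.inter (isOpen_lt continuous_const (by fun_prop))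
  have hRmem : ∀ z ∈ Ω, l < z 0 → withFirst z (2 * l - z 0) ∈ Ω := fun z hz hlz => by
    refine hsymm.withFirst_mem hz ?_
    rw [abs_le, abs_of_pos (hl.trans hlz)]
    constructor <;> linarith
  have hsub : Icc (x 0) b ⊆ {t | U (γ t) = 0} := by
    refine IsClosed.Icc_subset_of_forall_mem_nhdsWithin ?_ ?_ ?_
    · exact (isClosed_eq (hUc.comp hγc) continuous_const).inter isClosed_Icc
    · simp only [mem_ofPred_eq, hγ, withFirst_self, hUx]
      rw [← heq, sub_self]
    · rintro t ⟨ht, ht1, ht2⟩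
      have hloc := eventually_eq_zero_of_laplacian_le hO (U := U)
        (fun z hz => (h.laplacian_reflection_sub hΩ l hz.1
          (hRmem z hz.1 hz.2)).1.contDiffWithinAt) hκ.le
        (fun z hz => by
          rw [(h.laplacian_reflection_sub hΩ l hz.1 (hRmem z hz.1 hz.2)).2, hUx]
          linarith [(hle z hz.1 hz.2).2])
        (fun z hz => by
          rw [hUx]
          linarith [(hle z hz.1 hz.2).1])
        (z := γ t) ⟨hlt t ht1 ht2, by
          simp only [mem_ofPred_eq, hγ, withFirst_zero_apply]; linarith⟩ ht
      exact mem_nhdsWithin_of_mem_nhds (hγc.continuousAt.tendsto.eventually hloc)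
  have hUb : U (γ b) = 0 := hsub (right_mem_Icc.2 hxb.le)
  rw [hUx, h.fst_eq_zero _ hbT.2, sub_zero, hγ, withFirst_withFirst, withFirst_zero_apply] at hUb
  -- Here `l > 0` matters: the reflected exit point is strictly closer to `{x₁ = 0}`, hence in `Ω`
  -- by convexity from a point of the ray just before the exit.
  have habs : |2 * l - b| < b := by
    rw [abs_lt]
    constructor <;> linarith
  have hmem := hlt (max (x 0) |2 * l - b|) (le_max_left _ _) (max_lt hxb habs)
  have hmem2 := hsymm.withFirst_mem hmem (s := 2 * l - b) (by
    rw [hγ, withFirst_zero_apply]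
    exact (le_max_right _ _).trans (le_abs_self _))
  rw [hγ, withFirst_withFirst] at hmem2
  exact (h.pos _ hmem2).ne' hUb

/-- The mirror is placed through `x` itself. The reflected difference `U` vanishes at `x` and is
positive beyond the mirror, so Hopf's lemma gives it a positive derivative along `e₁`, and that
derivative is `-2 ∂u/∂x₁`. -/
theorem partialFirst_neg (h : IsNavierPair κ Ω u v) (hΩ : IsOpen Ω) (hb : Bornology.IsBounded Ω)
    (hκ : 0 < κ) (hκ2 : 2 ≤ κ ^ 2)
    (hext : ∃ r > 0, ∀ p ∈ frontier Ω, ∃ y, dist p y = r ∧ Disjoint (ball y r) Ω)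
    (hsymm : IsConvexSymmFirst Ω) {x : EuclideanSpace ℝ (Fin N)} (hx : x ∈ Ω) (hx0 : 0 < x 0) :
    partialFirst u x < 0 := by
  set l := x 0 with hl
  set R : EuclideanSpace ℝ (Fin N) → EuclideanSpace ℝ (Fin N) :=
    fun y => reflFirst N y + EuclideanSpace.single 0 (2 * l) with hR
  have hRw : ∀ z, R z = withFirst z (2 * l - z 0) := fun z => reflFirst_add_eq_withFirst z l
  have hRc : Continuous R := (reflFirst N).continuous.add continuous_const
  have hRx : R x = x := by rw [hRw, ← hl, two_mul, add_sub_cancel_right, hl, withFirst_self]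
  -- A neighbourhood of `x` on both sides of the mirror on which `U` is `C²`.
  set O := Ω ∩ R ⁻¹' Ω with hO
  have hOo : IsOpen O := hΩ.inter (hΩ.preimage hRc)
  have hxO : x ∈ O := ⟨hx, by rw [mem_preimage, hRx]; exact hx⟩
  obtain ⟨ρ', hρ', hball⟩ := nhds_basis_closedBall.mem_iff.1 (hOo.mem_nhds hxO)
  set ρ := ρ' / 2 with hρ
  have hρ0 : 0 < ρ := half_pos hρ'
  set e : EuclideanSpace ℝ (Fin N) := EuclideanSpace.single 0 1 with he
  set w := x + ρ • e with hw
  have hd : dist x w = ρ := by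
    rw [hw, dist_self_add_right, norm_smul, he, PiLp.norm_single, Real.norm_eq_abs,
      abs_of_pos hρ0]
    simp
  have hB : closedBall w (dist x w) ⊆ O := by
    refine Subset.trans (closedBall_subset_closedBall' ?_) hball
    rw [dist_comm w x, hd]
    linarith
  have hcap : ∀ z ∈ ball w (dist x w), l < z 0 := fun z hz => by
    rw [hd, mem_ball, dist_eq_norm] at hz
    have h1 := (PiLp.norm_apply_le (z - w) 0).trans_lt hz
    rw [Real.norm_eq_abs] at h1
    have h2 := (abs_lt.1 h1).1
    simp [hw, he] at h2
    linarith
  set U : EuclideanSpace ℝ (Fin N) → ℝ := fun y => u (R y) - u y with hU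
  have hC : ∀ z ∈ O, ContDiffAt ℝ 2 U z ∧ Δ U z = κ * U z - (v (R z) - v z) := fun z hz => by
    have hz2 : withFirst z (2 * l - z 0) ∈ Ω := by rw [← hRw]; exact hz.2
    have := h.laplacian_reflection_sub hΩ l hz.1 hz2
    rwa [← hRw] at this
  have hhopf := hopf_boundary_point hOo (U := U)
    (fun z hz => (hC z hz).1.contDiffWithinAt) hκ.le hB
    (fun heq => hρ0.ne (by rw [← hd, ← heq, dist_self]))
    (fun z hz => by
      have hzO := hB (ball_subset_closedBall hz)
      rw [(hC z hzO).2]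
      have := (h.le_reflection hΩ hb hκ hκ2 hext hsymm hx0.le hzO.1 (hcap z hz)).2
      rw [← hRw] at this
      linarith)
    (fun z hz => by
      have hzO := hB (ball_subset_closedBall hz)
      have := h.lt_reflection hΩ hb hκ hκ2 hext hsymm hx0 hzO.1 (hcap z hz)
      rw [← hRw] at this
      exact sub_pos.2 this)
    (by simp only [hU, hRx, sub_self])
  have hud : DifferentiableAt ℝ u x :=
    (h.contDiffOn_fst.contDiffAt (hΩ.mem_nhds hx)).differentiableAt (by simp)
  have hRd : HasFDerivAt R ((reflFirst N).toContinuousLinearEquiv : _ →L[ℝ] _) x :=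
    (reflFirst N).toContinuousLinearEquiv.hasFDerivAt.add_const _
  have hud' : HasFDerivAt u (fderiv ℝ u x) (R x) := by rw [hRx]; exact hud.hasFDerivAt
  have hUd : HasFDerivAt U _ x := (hud'.comp x hRd).sub hud.hasFDerivAt
  have hAe : reflFirst N e = -e := by
    ext i
    rw [reflFirst_apply]
    by_cases hi : i = 0
    · simp [hi]
    · simp [hi, he]
  have hwx : w - x = ρ • e := by rw [hw, add_sub_cancel_left]
  rw [hUd.fderiv, hwx, map_smul, smul_eq_mul] at hhopf
  have h1 : 0 < fderiv ℝ u x (reflFirst N e) - fderiv ℝ u x e :=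
    (mul_pos_iff_of_pos_left hρ0).1 hhopf
  rw [hAe, map_neg] at h1
  change fderiv ℝ u x e < 0
  linarith

end IsNavierPair

end Reflection

theorem proposition1p4 {N : ℕ} [NeZero N] (β : ℝ) (hβ : Real.sqrt 8 ≤ β)
    (Ω : Set (EuclideanSpace ℝ (Fin N)))
    (hΩ : IsHyperrectangle Ω ∨ IsSmoothBoundedDomain Ω)
    (hsymm : IsConvexSymmFirst Ω)
    (u : EuclideanSpace ℝ (Fin N) → ℝ)
    (hu : IsClassicalSolution β Ω u)
    (hpos : ∀ x ∈ Ω, 0 < u x) :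
    (∀ x ∈ Ω, u x = u (withFirst x (-(x 0)))) ∧
      (∀ x ∈ Ω, 0 < x 0 → partialFirst u x < 0) := by
  have hopen : IsOpen Ω := hΩ.elim (fun h => h.isOpen) fun h => h.isOpen
  have hb : Bornology.IsBounded Ω := hΩ.elim (fun h => h.isBounded) fun h => h.isBounded
  have hext := hΩ.elim (fun h => h.exists_exterior_ball) fun h => h.exists_exterior_ball
  have hβ0 : 0 < β := lt_of_lt_of_le (by positivity) hβ
  have hβ2 : 8 ≤ β ^ 2 := (Real.sqrt_le_left hβ0.le).1 hβ
  have hκ2 : 2 ≤ (β / 2) ^ 2 := by linarith [div_pow β 2 2]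
  have h := hu.isNavierPair hopen hpos
  refine ⟨fun x hx => ?_, fun x hx hx0 => ?_⟩
  · have h1 := h.eq_withFirst_neg hopen hb (half_pos hβ0) hκ2 hext hsymm hx
    rwa [indicator_of_mem hx,
      indicator_of_mem (hsymm.withFirst_mem hx (abs_neg _).le)] at h1
  · have h1 := h.partialFirst_neg hopen hb (half_pos hβ0) hκ2 hext hsymm hx hx0
    have h2 : Ω.indicator u =ᶠ[𝓝 x] u := by
      filter_upwards [hopen.mem_nhds hx] with y hy
      rw [indicator_of_mem hy]
    rwa [partialFirst, h2.fderiv_eq] at h1
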